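/- For $n\ge 0$ let $\mathcal F_{n,2}=\{\pi\in S_n : -1\le \pi(i)-i\le 2 \text{ for all } i\in[n]\}$ be the set of 2-Fibonacci permutations. The fixed order algorithm ${\tt A}_{f,2}$ samples from $\mathcal F_{n,2}$ by choosing $\pi(1),\pi(2),\dots,\pi(n)$ successively in this order: in step $i$, given $\pi(1),\dots,\pi(i-1)$, it chooses $\pi(i)$ uniformly at random among the remaining allowable options, that is, among those values $v\in[n]$ for which $\pi(1),\dots,\pi(i-1),v$ can still be completed to an element of $\mathcal F_{n,2}$. Let $P_{f,2}(\pi)$ be the probability that ${\tt A}_{f,2}$ outputs $\pi$, and put $T_{f,2}(\pi)=P_{f,2}(\pi)^{-1}$. Theorem. There are real constants $\mu_{f,2}$ and $\sigma_{f,2}>0$ with $\mu_{f,2}\doteq 0.6794$ and $\sigma_{f,2}^2\doteq 0.1592$ (rounded to four decimal places, i.e. $|\mu_{f,2}-0.6794|\le 5\cdot 10^{-5}$ and $|\sigma_{f,2}^2-0.1592|\le 5\cdot 10^{-5}$) such that, if $\pi$ is uniformly random on $\mathcal F_{n,2}$, then, as $n\to\infty$, $$\frac{\log T_{f,2}(\pi)-\mu_{f,2}\,n}{\sigma_{f,2}\sqrt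 n}\xrightarrow{d} N(0,1).$$ -/

import Mathlib

open MeasureTheory ProbabilityTheory Filter

noncomputable section

namespace FibMatching

/-- The 2-Fibonacci permutations `π` of `n` indices: `-1 ≤ π(i) - i ≤ 2` for every `i`.
(The indices are `0, …, n - 1`; the condition is invariant under the shift from `1, …, n`.) -/
def twoFib (n : ℕ) : Finset (Equiv.Perm (Fin n)) :=
  Finset.univ.filter fun π =>
    ∀ i : Fin n, -1 ≤ ((π i : ℕ) : ℤ) - ((i : ℕ) : ℤ) ∧ ((π i : ℕ) : ℤ) - ((i : ℕ) : ℤ) ≤ 2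

/-- The identity is a 2-Fibonacci permutation. -/
theorem one_mem_twoFib (n : ℕ) : (1 : Equiv.Perm (Fin n)) ∈ twoFib n := by
  simp [twoFib]

instance (n : ℕ) : Nonempty (twoFib n) := ⟨⟨1, one_mem_twoFib n⟩⟩

/-- Every set of 2-Fibonacci permutations is an event. -/
instance (n : ℕ) : MeasurableSpace (twoFib n) := ⊤

/-- The uniform probability measure `u` on the 2-Fibonacci permutations. -/
def uniform (n : ℕ) : Measure (twoFib n) := (PMF.uniformOfFintype (twoFib n)).toMeasure

instance (n : ℕ) : IsProbabilityMeasure (uniform n) := by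
  unfold uniform
  infer_instance

/-- The remaining allowable options for the next index, when the first `l.length` indices have
been matched with the entries of `l`, in this order: the values `v` such that `l` followed by `v`
can be completed to (the one-line notation of) a 2-Fibonacci permutation. In particular,
such a `v` does not occur in `l`. -/
def allowable (n : ℕ) (l : List (Fin n)) : Finset (Fin n) :=
  Finset.univ.filter fun v => ∃ π ∈ twoFib n, (l ++ [v]) <+: List.ofFn π

/-- The law of the list of choices of the fixed order algorithm after its first `k` steps. In each
step the next index is matched with a uniformly random allowable option.
(The `else` branch is only reached once all `n` indices have been matched.) -/
def fixedOrder (n : ℕ) : ℕ → PMF (List (Fin n))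
  | 0 => PMF.pure []
  | k + 1 => (fixedOrder n k).bind fun l =>
      if h : (allowable n l).Nonempty then
        (PMF.uniformOfFinset (allowable n l) h).map fun v => l ++ [v]
      else PMF.pure l

/-- The probability `P(π)` that the fixed order algorithm, after all its `n` steps,
outputs `π`. -/
def prob {n : ℕ} (π : Equiv.Perm (Fin n)) : ℝ :=
  (fixedOrder n n (List.ofFn π)).toReal

/-- `T(π) = P(π)⁻¹`. -/
def invProb {n : ℕ} (π : Equiv.Perm (Fin n)) : ℝ := (prob π)⁻¹

end FibMatching

end

noncomputable section

namespace FibMatching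

open Topology Asymptotics

/-! A 2-Fibonacci permutation is a concatenation of blocks of 1, 2 or 3 consecutive indices, each a
cycle sending its first index to its last and every other index down by one. The algorithm is free
only at a block's first index `k`, with `min 3 (n - k)` options; so `T(π)` is a product over blocks,
and `log T` is `log 3` times the number of blocks up to a boundary correction.

Removing the first block gives `F_{n+3} = e^{itL} (F_{n+2} + F_{n+1} + F_n)` for `F_n(t) = ∑ exp(it
log T)` and `L = log 3` (`expSum_add_three`). Let `x(t)` solve `x + x² + x³ = e^{-itL}` near the
positive root `x₀` at `t = 0`. Then `B_n = F_n xⁿ` obeys a recurrence with characteristic root 1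
whose other roots are uniformly contracting near 0, so `B_n(τ_n)` has the same nonzero limit for
every `τ_n → 0` (`tendsto_of_recurrence`). With `τ = s / (σ√n)` the characteristic function is `(x₀
/ x(τ) · e^{-iμτ})ⁿ` times `B_n(τ) / B_n(0) → 1`. A second-order expansion of the base
(`isLittleO_branch`) gives the limit `e^{-s²/2}`, and Lévy's continuity theorem concludes. -/

/-! ### Output probabilities as products of option counts -/

theorem length_le_of_fixedOrder_ne_zero {n k : ℕ} {l : List (Fin n)}
    (h : fixedOrder n k l ≠ 0) : l.length ≤ k := by
  induction k generalizing l with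
  | zero =>
    have : l ∈ (PMF.pure ([] : List (Fin n))).support := h
    simp_all
  | succ k ih =>
    have : l ∈ (fixedOrder n (k + 1)).support := h
    rw [fixedOrder, PMF.mem_support_bind_iff] at this
    obtain ⟨a, ha, hl⟩ := this
    have := ih ha
    split_ifs at hl with hne
    · rw [PMF.mem_support_map_iff] at hl
      obtain ⟨v, -, rfl⟩ := hl
      simpa using this
    · simp only [PMF.support_pure, Set.mem_singleton_iff] at hl
      subst hl
      omega

theorem fixedOrder_succ_concat {n k : ℕ} {l : List (Fin n)} (hl : l.length = k) {v : Fin n}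
    (hv : v ∈ allowable n l) :
    fixedOrder n (k + 1) (l ++ [v]) = fixedOrder n k l * ((allowable n l).card : ENNReal)⁻¹ := by
  have hne : (allowable n l).Nonempty := ⟨v, hv⟩
  rw [fixedOrder, PMF.bind_apply, tsum_eq_single l]
  · rw [dif_pos hne, PMF.map_apply, tsum_eq_single v]
    · simp [PMF.uniformOfFinset_apply_of_mem hne hv]
    · intro w hw
      simp [hw.symm]
  · intro a ha
    by_contra hcon
    have h1 := left_ne_zero_of_mul hcon
    have h2 := right_ne_zero_of_mul hcon
    have hlen := length_le_of_fixedOrder_ne_zero h1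
    rw [← PMF.mem_support_iff] at h2
    split_ifs at h2 with hne'
    · rw [PMF.mem_support_map_iff] at h2
      obtain ⟨w, -, hw⟩ := h2
      exact ha (List.append_inj_left' hw rfl)
    -- The `else` branch would need `a = l ++ [v]`, which is too long after `k` steps.
    · simp only [PMF.support_pure, Set.mem_singleton_iff] at h2
      subst h2
      simp at hlen
      omega

theorem take_ofFn_succ {n k : ℕ} (π : Equiv.Perm (Fin n)) (hk : k < n) :
    (List.ofFn π).take (k + 1) = (List.ofFn π).take k ++ [π ⟨k, hk⟩] := by
  rw [List.take_succ_eq_append_getElem (by simpa using hk)]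
  simp

theorem take_concat_prefix_iff {n k : ℕ} (π ρ : Equiv.Perm (Fin n)) (hk : k < n) (v : Fin n) :
    ((List.ofFn π).take k ++ [v]) <+: List.ofFn ρ ↔
      (∀ j : Fin n, (j : ℕ) < k → ρ j = π j) ∧ ρ ⟨k, hk⟩ = v := by
  rw [List.prefix_iff_eq_take]
  have : ((List.ofFn π).take k ++ [v]).length = k + 1 := by simp; omega
  rw [this, take_ofFn_succ ρ hk]
  constructor
  · intro h
    have h1 := List.append_inj_left' h rfl
    have h2 := List.append_inj_right' h rfl
    refine ⟨fun j hj => ?_, by simpa using h2.symm⟩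
    have := congrArg (fun l => l[(j : ℕ)]?) h1
    simpa [List.getElem?_take, hj, List.getElem?_ofFn] using this.symm
  · rintro ⟨h1, rfl⟩
    congr 1
    apply List.ext_getElem
    · simp
    · intro i hi hi'
      simp at hi ⊢
      rw [h1 ⟨i, by omega⟩ (by simp; omega)]

theorem mem_allowable_take_iff {n k : ℕ} (π : Equiv.Perm (Fin n)) (hk : k < n) (v : Fin n) :
    v ∈ allowable n ((List.ofFn π).take k) ↔
      ∃ ρ ∈ twoFib n, (∀ j : Fin n, (j : ℕ) < k → ρ j = π j) ∧ ρ ⟨k, hk⟩ = v := by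
  simp [allowable, take_concat_prefix_iff π _ hk]

theorem fixedOrder_take {n k : ℕ} {π : Equiv.Perm (Fin n)} (hπ : π ∈ twoFib n) (hk : k ≤ n) :
    fixedOrder n k ((List.ofFn π).take k) =
      ∏ j ∈ Finset.range k, ((allowable n ((List.ofFn π).take j)).card : ENNReal)⁻¹ := by
  induction k with
  | zero => simp [fixedOrder]
  | succ k ih =>
    rw [take_ofFn_succ π hk, fixedOrder_succ_concat (by simp; omega), ih (by omega),
      Finset.prod_range_succ]
    rw [mem_allowable_take_iff π hk]
    exact ⟨π, hπ, fun _ _ => rfl, rfl⟩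

theorem invProb_eq_prod_card_allowable {n : ℕ} {π : Equiv.Perm (Fin n)} (hπ : π ∈ twoFib n) :
    invProb π = ∏ j : Fin n, ((allowable n ((List.ofFn π).take j)).card : ℝ) := by
  have h := fixedOrder_take hπ le_rfl
  rw [List.take_of_length_le (by simp)] at h
  rw [invProb, prob, h, ENNReal.toReal_prod, ← Finset.prod_inv_distrib, Finset.prod_range]
  simp

/-! ### Block structure and the number of options -/

theorem mem_twoFib_iff {n : ℕ} {π : Equiv.Perm (Fin n)} :
    π ∈ twoFib n ↔ ∀ i : Fin n, (i : ℕ) ≤ π i + 1 ∧ (π i : ℕ) ≤ i + 2 := by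
  simp only [twoFib, Finset.mem_filter, Finset.mem_univ, true_and]
  refine forall_congr' fun i => ?_
  omega

/-- If the first `k` indices are not matched among themselves, then `k` is matched with `k - 1`. -/
theorem apply_succ_eq_of_exists_le {n k : ℕ} {π : Equiv.Perm (Fin n)} (hπ : π ∈ twoFib n)
    (hk : k < n) (h : ∃ j : Fin n, (j : ℕ) < k ∧ k ≤ (π j : ℕ)) : (π ⟨k, hk⟩ : ℕ) + 1 = k := by
  rw [mem_twoFib_iff] at hπ
  obtain ⟨j, hj, hjk⟩ := h
  -- Pigeonhole: since `j < k` leaves the initial segment, some value below `k` is taken by an index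
  -- at least `k`; the bound `π i ≥ i - 1` then forces that index to be `k`.
  have key : ∃ u : Fin n, (u : ℕ) < k ∧ k ≤ (π.symm u : ℕ) := by
    by_contra! hcon
    have hmaps : Set.MapsTo π.symm {u : Fin n | (u : ℕ) < k} {u : Fin n | (u : ℕ) < k} :=
      fun u hu => hcon u hu
    have := Equiv.Perm.perm_symm_mapsTo_of_mapsTo _ hmaps hj
    simp at this
    omega
  obtain ⟨u, hu, huk⟩ := key
  have h1 := hπ (π.symm u)
  rw [π.apply_symm_apply] at h1
  have : π.symm u = ⟨k, hk⟩ := Fin.ext (by simp; omega)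
  rw [← this, π.apply_symm_apply]
  rw [this] at h1
  simp at h1
  omega

/-- If the first `k` indices are matched among themselves, then they can be followed by a cycle
which matches `k` with `v`. -/
theorem exists_mem_twoFib_apply_eq {n k v : ℕ} {π : Equiv.Perm (Fin n)} (hπ : π ∈ twoFib n)
    (hk : k < n) (h : ∀ j : Fin n, (j : ℕ) < k → (π j : ℕ) < k) (hkv : k ≤ v) (hvk : v ≤ k + 2)
    (hv : v < n) :
    ∃ ρ ∈ twoFib n, (∀ j : Fin n, (j : ℕ) < k → ρ j = π j) ∧ ρ ⟨k, hk⟩ = ⟨v, hv⟩ := by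
  rw [mem_twoFib_iff] at hπ
  -- Keep the prefix, put the cycle `k ↦ v`, `i ↦ i - 1` on `k < i ≤ v`, and the identity beyond.
  let f : Fin n → Fin n := fun i =>
    if (i : ℕ) < k then π i else if (i : ℕ) = k then ⟨v, hv⟩ else
      if (i : ℕ) ≤ v then ⟨i - 1, by omega⟩ else i
  have hf : f.Injective := by
    intro i j hij
    have hi := h i
    have hj := h j
    by_cases hik : (i : ℕ) < k
    · by_cases hjk : (j : ℕ) < k
      · simp only [f, hik, hjk, if_true] at hij
        exact π.injective hij
      · have := congrArg Fin.val hij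
        simp only [f, hik, hjk, if_true, if_false] at this
        split_ifs at this <;> (try simp only at this) <;> omega
    · apply Fin.ext
      have := congrArg Fin.val hij
      simp only [f, hik, if_false] at this
      split_ifs at this <;> (try simp only at this) <;> omega
  refine ⟨Equiv.ofBijective f (Finite.injective_iff_bijective.mp hf), ?_, ?_, ?_⟩
  · rw [mem_twoFib_iff]
    intro i
    have := hπ i
    simp only [Equiv.ofBijective_apply, f]
    split_ifs <;> (try simp only) <;> omega
  · intro j hj
    simp [f, hj]
  · simp [f]

/-- If a block is still open at `k`, the value `k - 1` is forced. Otherwise `k` starts a block,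
whose last index can be any of `k`, `k + 1`, `k + 2` below `n`. -/
theorem card_allowable_take {n : ℕ} {π : Equiv.Perm (Fin n)} (hπ : π ∈ twoFib n) (k : Fin n) :
    (allowable n ((List.ofFn π).take k)).card = if k ≤ π k then min 3 (n - k) else 1 := by
  by_cases h : ∃ j : Fin n, (j : ℕ) < k ∧ (k : ℕ) ≤ (π j : ℕ)
  · have hπk := apply_succ_eq_of_exists_le hπ k.2 h
    rw [if_neg (by rw [Fin.le_def]; simp at hπk; omega), Finset.card_eq_one]
    refine ⟨π k, Finset.ext fun v => ?_⟩
    rw [mem_allowable_take_iff π k.2, Finset.mem_singleton]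
    constructor
    · rintro ⟨ρ, hρ, hρπ, rfl⟩
      obtain ⟨j, hj, hjk⟩ := h
      have := apply_succ_eq_of_exists_le hρ k.2 ⟨j, hj, by rwa [hρπ j hj]⟩
      apply Fin.ext
      simp at hπk this ⊢
      omega
    · rintro rfl
      exact ⟨π, hπ, fun _ _ => rfl, rfl⟩
  · push Not at h
    have hstart : ∀ ρ : Equiv.Perm (Fin n), (∀ j : Fin n, (j : ℕ) < k → ρ j = π j) →
        (k : ℕ) ≤ ρ k := by
      intro ρ hρ
      by_contra! hcon
      have hmaps : Set.MapsTo ρ {u : Fin n | (u : ℕ) < k} {u : Fin n | (u : ℕ) < k} :=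
        fun u hu => by simpa [hρ u hu] using h u hu
      have := Equiv.Perm.perm_symm_mapsTo_of_mapsTo _ hmaps hcon
      simp at this
    rw [if_pos (by exact hstart π fun _ _ => rfl)]
    have : allowable n ((List.ofFn π).take k) =
        (Finset.Ico (k : ℕ) (min (k + 3) n)).attachFin fun i hi => by simp at hi; omega := by
      ext v
      rw [mem_allowable_take_iff π k.2, Finset.mem_attachFin, Finset.mem_Ico]
      constructor
      · rintro ⟨ρ, hρ, hρπ, rfl⟩
        have h1 := hstart ρ hρπ
        have h2 := (mem_twoFib_iff.1 hρ k).2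
        simp
        omega
      · intro hv
        exact exists_mem_twoFib_apply_eq hπ k.2 h (by omega) (by omega) v.2
    rw [this, Finset.card_attachFin, Nat.card_Ico]
    omega

theorem invProb_eq_prod {n : ℕ} {π : Equiv.Perm (Fin n)} (hπ : π ∈ twoFib n) :
    invProb π = ∏ k : Fin n, if k ≤ π k then ((min 3 (n - (k : ℕ)) : ℕ) : ℝ) else 1 := by
  rw [invProb_eq_prod_card_allowable hπ]
  refine Finset.prod_congr rfl fun k _ => ?_
  rw [card_allowable_take hπ]
  split_ifs <;> simp

/-! ### Recurrence for weighted sums -/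

/-- The product of `u (n - k)` over the first indices `k` of the cycles of `π ∈ twoFib n`. -/
def cycleWeight (u : ℕ → ℂ) {n : ℕ} (π : Equiv.Perm (Fin n)) : ℂ :=
  ∏ k : Fin n, if k ≤ π k then u (n - k) else 1

/-- The sum of the weights of the 2-Fibonacci permutations. -/
def weightSum (u : ℕ → ℂ) (n : ℕ) : ℂ :=
  ∑ π ∈ twoFib n, cycleWeight u π

/-- The sum of the weights of the 2-Fibonacci permutations which map `0` to `p`. -/
def weightSumAt (u : ℕ → ℂ) (n : ℕ) (p : Fin (n + 1)) : ℂ :=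
  ∑ π ∈ twoFib (n + 1) with π 0 = p, cycleWeight u π

theorem weightSum_succ (u : ℕ → ℂ) (n : ℕ) :
    weightSum u (n + 1) = ∑ p, weightSumAt u n p :=
  (Finset.sum_fiberwise _ (fun π : Equiv.Perm (Fin (n + 1)) => π 0) _).symm

theorem weightSumAt_eq_zero (u : ℕ → ℂ) {n : ℕ} {p : Fin (n + 1)} (hp : 2 < (p : ℕ)) :
    weightSumAt u n p = 0 := by
  rw [weightSumAt, Finset.filter_false_of_mem, Finset.sum_empty]
  rintro π hπ rfl
  have := (mem_twoFib_iff.1 hπ 0).2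
  simp at this
  omega

/-- Delete the fixed point 0. Weights depend on the distance `n - k` to the end, so the remaining
ones are unchanged. -/
theorem weightSumAt_zero (u : ℕ → ℂ) (n : ℕ) :
    weightSumAt u n 0 = u (n + 1) * weightSum u n := by
  rw [weightSumAt, weightSum, Finset.mul_sum]
  symm
  refine Finset.sum_bij (fun e _ => Equiv.Perm.decomposeFin.symm (0, e)) ?_ ?_ ?_ ?_
  · intro e he
    rw [mem_twoFib_iff] at he
    simp only [Finset.mem_filter, mem_twoFib_iff, Fin.forall_fin_succ,
      Equiv.Perm.decomposeFin_symm_apply_zero, Equiv.Perm.decomposeFin_symm_apply_succ]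
    simpa using he
  · intro a _ b _ h
    simpa using h
  · intro σ hσ
    obtain ⟨⟨p, e⟩, rfl⟩ := Equiv.Perm.decomposeFin.symm.surjective σ
    simp only [Finset.mem_filter, mem_twoFib_iff, Fin.forall_fin_succ,
      Equiv.Perm.decomposeFin_symm_apply_zero, Equiv.Perm.decomposeFin_symm_apply_succ] at hσ
    obtain ⟨hσ, rfl⟩ := hσ
    refine ⟨e, ?_, rfl⟩
    rw [mem_twoFib_iff]
    simpa using hσ
  · intro e _
    rw [cycleWeight, cycleWeight, Fin.prod_univ_succ]
    simp [Fin.succ_le_succ_iff]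

theorem decomposeFin_symm_apply_succ_of_apply_zero {n : ℕ} {p : Fin (n + 1)}
    {e : Equiv.Perm (Fin (n + 1))} (h : e 0 = p) (i : Fin (n + 1)) :
    Equiv.Perm.decomposeFin.symm (p.succ, e) i.succ = if i = 0 then 0 else (e i).succ := by
  rw [Equiv.Perm.decomposeFin_symm_apply_succ]
  split_ifs with hi
  · rw [hi, h, Equiv.swap_apply_right]
  · refine Equiv.swap_apply_of_ne_of_ne (Fin.succ_ne_zero _) fun hcon => hi ?_
    rw [← h] at hcon
    exact e.injective (Fin.succ_injective _ hcon)

theorem decomposeFin_symm_mem_twoFib_iff {n : ℕ} {p : Fin (n + 1)} (hp : (p : ℕ) ≤ 1)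
    {e : Equiv.Perm (Fin (n + 1))} (h : e 0 = p) :
    Equiv.Perm.decomposeFin.symm (p.succ, e) ∈ twoFib (n + 2) ↔ e ∈ twoFib (n + 1) := by
  rw [mem_twoFib_iff, mem_twoFib_iff, Fin.forall_fin_succ (n := n + 1)]
  simp only [Equiv.Perm.decomposeFin_symm_apply_zero, decomposeFin_symm_apply_succ_of_apply_zero h]
  constructor
  · rintro ⟨-, H⟩ i
    have := H i
    split_ifs at this with hi
    · subst hi
      rw [h]
      simp
      omega
    · simpa using this
  · intro H
    refine ⟨by simp; omega, fun i => ?_⟩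
    split_ifs with hi
    · subst hi
      simp
    · simpa using H i

/-- Inserting a new index in front of the first block lengthens it by one; only the weight of its
first index changes, from `u (n + 1)` to `u (n + 2)`. -/
theorem weightSumAt_succ {u : ℕ → ℂ} (hu : ∀ m, u m ≠ 0) {n : ℕ} {p : Fin (n + 1)}
    (hp : (p : ℕ) ≤ 1) :
    weightSumAt u (n + 1) p.succ = u (n + 2) / u (n + 1) * weightSumAt u n p := by
  rw [weightSumAt, weightSumAt, Finset.mul_sum]
  symm
  refine Finset.sum_bij (fun e _ => Equiv.Perm.decomposeFin.symm (p.succ, e)) ?_ ?_ ?_ ?_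
  · intro e he
    rw [Finset.mem_filter] at he ⊢
    exact ⟨(decomposeFin_symm_mem_twoFib_iff hp he.2).2 he.1,
      Equiv.Perm.decomposeFin_symm_apply_zero _ _⟩
  · intro a _ b _ h
    simpa using h
  · intro σ hσ
    obtain ⟨⟨q, e⟩, rfl⟩ := Equiv.Perm.decomposeFin.symm.surjective σ
    rw [Finset.mem_filter, Equiv.Perm.decomposeFin_symm_apply_zero] at hσ
    obtain ⟨hσ, rfl⟩ := hσ
    have he : e 0 = p := by
      -- As 0 goes to a positive value, 1 must go to 0.
      have h1 := apply_succ_eq_of_exists_le hσ (k := 1) (by omega) ⟨0, by simp⟩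
      have h2 : Equiv.Perm.decomposeFin.symm (p.succ, e) (Fin.succ 0) = 0 := by
        apply Fin.ext
        simpa using h1
      rw [Equiv.Perm.decomposeFin_symm_apply_succ, Equiv.swap_apply_eq_iff,
        Equiv.swap_apply_left] at h2
      exact Fin.succ_injective _ h2
    refine ⟨e, ?_, rfl⟩
    rw [Finset.mem_filter]
    exact ⟨(decomposeFin_symm_mem_twoFib_iff hp he).1 hσ, he⟩
  · intro e he
    have he := (Finset.mem_filter.1 he).2
    rw [cycleWeight, cycleWeight, Fin.prod_univ_succ, Fin.prod_univ_succ, Fin.prod_univ_succ]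
    simp only [Equiv.Perm.decomposeFin_symm_apply_zero,
      decomposeFin_symm_apply_succ_of_apply_zero he]
    have := hu (n + 1)
    simp [Fin.succ_le_succ_iff]
    field_simp

theorem weightSum_add_three {u : ℕ → ℂ} (hu : ∀ m, u m ≠ 0) (n : ℕ) :
    weightSum u (n + 3) =
      u (n + 3) * (weightSum u (n + 2) + weightSum u (n + 1) + weightSum u n) := by
  have h1 : ∀ m, weightSumAt u (m + 1) (Fin.succ 0) = u (m + 2) * weightSum u m := by
    intro m
    rw [weightSumAt_succ hu (by simp), weightSumAt_zero]
    have := hu (m + 1)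
    field_simp
  have h2 : weightSumAt u (n + 2) (Fin.succ (Fin.succ 0)) = u (n + 3) * weightSum u n := by
    rw [weightSumAt_succ hu (by simp), h1]
    have := hu (n + 2)
    field_simp
  rw [weightSum_succ, Fin.sum_univ_succ, Fin.sum_univ_succ, Fin.sum_univ_succ, h1, h2,
    weightSumAt_zero, Finset.sum_eq_zero]
  · ring
  · intro i _
    exact weightSumAt_eq_zero u (by simp)

/-! ### Exponential sums and the characteristic function -/

theorem exp_log_invProb {n : ℕ} {π : Equiv.Perm (Fin n)} (hπ : π ∈ twoFib n) (t : ℝ) :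
    Complex.exp (t * Complex.I * Real.log (invProb π)) =
      cycleWeight (fun m => Complex.exp (t * Complex.I * Real.log (min 3 m : ℕ))) π := by
  rw [invProb_eq_prod hπ, Real.log_prod, cycleWeight, Complex.ofReal_sum, Finset.mul_sum,
    Complex.exp_sum]
  · refine Finset.prod_congr rfl fun k _ => ?_
    split_ifs <;> simp
  · intro k _
    split_ifs
    · have := k.2
      rw [Nat.cast_ne_zero]
      omega
    · simp

/-- The sum of `exp (i t log T)` over the 2-Fibonacci permutations. -/
def expSum (n : ℕ) (t : ℝ) : ℂ :=
  ∑ π ∈ twoFib n, Complex.exp (t * Complex.I * Real.log (invProb π))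

/-- Since `min 3 (n + 3) = 3`, the coefficients are constant in `n`; the boundary effect survives
only in the initial values. -/
theorem expSum_add_three (n : ℕ) (t : ℝ) :
    expSum (n + 3) t = Complex.exp (t * Complex.I * Real.log 3) *
      (expSum (n + 2) t + expSum (n + 1) t + expSum n t) := by
  have h : ∀ n, expSum n t =
      weightSum (fun m => Complex.exp (t * Complex.I * Real.log (min 3 m : ℕ))) n :=
    fun n => Finset.sum_congr rfl fun π hπ => exp_log_invProb hπ t
  rw [h, weightSum_add_three (fun _ => Complex.exp_ne_zero _), h, h, h]
  simp

theorem continuous_expSum (n : ℕ) : Continuous (expSum n) := by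
  unfold expSum
  fun_prop

theorem expSum_zero (n : ℕ) : expSum n 0 = (twoFib n).card := by
  simp [expSum]

theorem charFun_uniform_map (n : ℕ) (a b s : ℝ) :
    charFun ((uniform n).map fun π => (Real.log (invProb π.1) - a) / b) s =
      Complex.exp (-(s / b : ℝ) * Complex.I * a) * (expSum n (s / b) / expSum n 0) := by
  rw [charFun_apply_real, integral_map (measurable_of_finite _).aemeasurable (by fun_prop),
    uniform, PMF.integral_eq_sum, expSum_zero, expSum, ← Finset.sum_coe_sort (twoFib n),
    Finset.sum_div, Finset.mul_sum]
  refine Finset.sum_congr rfl fun π _ => ?_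
  rw [PMF.uniformOfFintype_apply, Complex.real_smul, mul_div_assoc', ← Complex.exp_add]
  refine (congrArg₂ (· * ·) ?_ (congrArg Complex.exp ?_)).trans (div_eq_inv_mul _ _).symm
  · simp
  · push_cast
    ring

/-! ### Taylor expansion and perturbed recurrences -/

/-- Taylor's theorem of order two with Peano's remainder at `0`. -/
theorem isLittleO_sub_sub_of_hasDerivAt {h k : ℝ → ℂ} {c : ℂ}
    (hh : ∀ᶠ t in 𝓝 0, HasDerivAt h (k t) t) (hk0 : k 0 = 0) (hk : HasDerivAt k c 0) :
    (fun t : ℝ => h t - (h 0 + c * (t : ℂ) ^ 2 / 2)) =o[𝓝 0] fun t : ℝ => t ^ 2 := by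
  rw [isLittleO_iff]
  intro ε hε
  have hk' := (hasDerivAt_iff_isLittleO.1 hk).def hε
  obtain ⟨δ, hδ, hball⟩ := Metric.eventually_nhds_iff_ball.1 (hh.and hk')
  refine Metric.eventually_nhds_iff_ball.2 ⟨δ, hδ, fun t ht => ?_⟩
  have hsub : ∀ y ∈ Metric.closedBall (0 : ℝ) |t|, y ∈ Metric.ball (0 : ℝ) δ := by
    intro y hy
    rw [mem_closedBall_zero_iff] at hy
    rw [mem_ball_zero_iff] at ht ⊢
    exact hy.trans_lt ht
  -- Mean value inequality for the remainder, whose derivative `k y - c y` is at most `ε |t|` on the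
  -- ball of radius `|t|`.
  have hmv := Convex.norm_image_sub_le_of_norm_hasDerivWithin_le
    (f := fun t : ℝ => h t - (h 0 + c * (t : ℂ) ^ 2 / 2)) (f' := fun t : ℝ => k t - c * t)
    (C := ε * |t|) (s := Metric.closedBall (0 : ℝ) |t|) (x := 0) (y := t) ?_ ?_
    (convex_closedBall _ _) (by simp) (by simp)
  · simpa [mul_assoc, sq] using hmv
  · intro y hy
    refine HasDerivAt.hasDerivWithinAt ((hball y (hsub y hy)).1.sub ?_)
    have h1 : HasDerivAt (fun y : ℝ => (y : ℂ)) 1 y := Complex.ofRealCLM.hasDerivAt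
    convert! (((h1.pow 2).const_mul c).div_const 2).const_add (h 0) using 1
    simp
    ring
  · intro y hy
    have h2 := (hball y (hsub y hy)).2
    rw [mem_closedBall_zero_iff] at hy
    simp only [hk0, sub_zero, Complex.real_smul] at h2
    rw [mul_comm c]
    refine h2.trans ?_
    gcongr

/-- The characteristic polynomial is `(z - 1)(z² + (q + r) z + r)`, so the differences satisfy the
order-two recurrence of the second factor, which gains a factor `ρ` every two steps. -/
theorem norm_sub_le_of_recurrence {p q r : ℂ} (hpqr : p + q + r = 1) {ρ : ℝ} (hρ1 : ρ ≤ 1)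
    (hρ : ‖q + r‖ + ‖r‖ ≤ ρ) {B : ℕ → ℂ}
    (hB : ∀ n, B (n + 3) = p * B (n + 2) + q * B (n + 1) + r * B n) {M : ℝ}
    (h0 : ‖B 1 - B 0‖ ≤ M) (h1 : ‖B 2 - B 1‖ ≤ M) (n : ℕ) :
    ‖B (n + 1) - B n‖ ≤ M * ρ ^ (n / 2) := by
  have hM : 0 ≤ M := (norm_nonneg _).trans h0
  have hρ0 : 0 ≤ ρ := le_trans (by positivity) hρ
  induction n using Nat.twoStepInduction with
  | zero => simpa using h0
  | one => simpa using h1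
  | more n ih0 ih1 =>
    have hD : B (n + 2 + 1) - B (n + 2) =
        -((q + r) * (B (n + 1 + 1) - B (n + 1)) + r * (B (n + 1) - B n)) := by
      rw [hB, show p = 1 - q - r by rw [← hpqr]; ring]
      ring
    have hle : ρ ^ ((n + 1) / 2) ≤ ρ ^ (n / 2) :=
      pow_le_pow_of_le_one hρ0 hρ1 (by omega)
    rw [hD, norm_neg, show (n + 2) / 2 = n / 2 + 1 by omega]
    calc _ ≤ ‖q + r‖ * ‖B (n + 1 + 1) - B (n + 1)‖ + ‖r‖ * ‖B (n + 1) - B n‖ := by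
          rw [← norm_mul, ← norm_mul]
          exact norm_add_le _ _
      _ ≤ ‖q + r‖ * (M * ρ ^ (n / 2)) + ‖r‖ * (M * ρ ^ (n / 2)) := by
          gcongr
          exact ih1.trans (by gcongr)
      _ = (‖q + r‖ + ‖r‖) * (M * ρ ^ (n / 2)) := by ring
      _ ≤ ρ * (M * ρ ^ (n / 2)) := by gcongr
      _ = _ := by ring

/-- The quadratic factor applied to `B` is fixed by the remaining factor `z - 1`; this conserved
quantity identifies the limit. -/
theorem recurrence_invariant {p q r : ℂ} (hpqr : p + q + r = 1) {B : ℕ → ℂ}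
    (hB : ∀ n, B (n + 3) = p * B (n + 2) + q * B (n + 1) + r * B n) (n : ℕ) :
    B (n + 2) + (q + r) * B (n + 1) + r * B n = B 2 + (q + r) * B 1 + r * B 0 := by
  induction n with
  | zero => rfl
  | succ n ih =>
    rw [← ih, hB, show p = 1 - q - r by rw [← hpqr]; ring]
    ring

/-- Replacing all three terms of the invariant by `B (n + 2)` costs only consecutive differences,
which decay geometrically. -/
theorem norm_mul_sub_le_of_recurrence {p q r : ℂ} (hpqr : p + q + r = 1) {ρ : ℝ} (hρ1 : ρ ≤ 1)
    (hρ : ‖q + r‖ + ‖r‖ ≤ ρ) {B : ℕ → ℂ}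
    (hB : ∀ n, B (n + 3) = p * B (n + 2) + q * B (n + 1) + r * B n) {M : ℝ}
    (h0 : ‖B 1 - B 0‖ ≤ M) (h1 : ‖B 2 - B 1‖ ≤ M) (n : ℕ) :
    ‖(1 + (q + r) + r) * B (n + 2) - (B 2 + (q + r) * B 1 + r * B 0)‖ ≤
      2 * M * ρ ^ (n / 2) := by
  have hM : 0 ≤ M := (norm_nonneg _).trans h0
  have hρ0 : 0 ≤ ρ := le_trans (by positivity) hρ
  have hD := norm_sub_le_of_recurrence hpqr hρ1 hρ hB h0 h1
  have hle : ρ ^ ((n + 1) / 2) ≤ ρ ^ (n / 2) := pow_le_pow_of_le_one hρ0 hρ1 (by omega)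
  have hD1 : ‖B (n + 1 + 1) - B (n + 1)‖ ≤ M * ρ ^ (n / 2) := (hD _).trans (by gcongr)
  rw [← recurrence_invariant hpqr hB n]
  calc _ = ‖(q + r) * (B (n + 1 + 1) - B (n + 1)) +
        r * ((B (n + 1 + 1) - B (n + 1)) + (B (n + 1) - B n))‖ := by congr 1; ring
    _ ≤ ‖q + r‖ * ‖B (n + 1 + 1) - B (n + 1)‖ +
        ‖r‖ * (‖B (n + 1 + 1) - B (n + 1)‖ + ‖B (n + 1) - B n‖) := by
        refine (norm_add_le _ _).trans ?_
        rw [norm_mul, norm_mul]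
        gcongr
        exact norm_add_le _ _
    _ ≤ ‖q + r‖ * (M * ρ ^ (n / 2)) + ‖r‖ * (M * ρ ^ (n / 2) + M * ρ ^ (n / 2)) := by
        gcongr
        exact hD n
    _ = (‖q + r‖ + ‖r‖ + ‖r‖) * (M * ρ ^ (n / 2)) := by ring
    _ ≤ 2 * (M * ρ ^ (n / 2)) := by
        gcongr
        have := norm_nonneg (q + r)
        linarith
    _ = _ := by ring

/-- A family of solutions of recurrences of order three with dominant characteristic root `1`
converges along every sequence of parameters which tends to `0`. -/
theorem tendsto_of_recurrence {q r : ℝ → ℂ} (hq : ContinuousAt q 0) (hr : ContinuousAt r 0)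
    (hρ : ‖q 0 + r 0‖ + ‖r 0‖ < 1) (h1 : 1 + (q 0 + r 0) + r 0 ≠ 0) {B : ℕ → ℝ → ℂ}
    (hcont : ∀ n, ContinuousAt (B n) 0)
    (hB : ∀ᶠ t in 𝓝 0, ∀ n,
      B (n + 3) t = (1 - q t - r t) * B (n + 2) t + q t * B (n + 1) t + r t * B n t)
    {τ : ℕ → ℝ} (hτ : Tendsto τ atTop (𝓝 0)) :
    Tendsto (fun n => B n (τ n)) atTop
      (𝓝 ((B 2 0 + (q 0 + r 0) * B 1 0 + r 0 * B 0 0) / (1 + (q 0 + r 0) + r 0))) := by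
  obtain ⟨ρ, hρ', hρ1⟩ := exists_between hρ
  have hρ0 : 0 ≤ ρ := le_trans (by positivity) hρ'.le
  have hev1 : ∀ᶠ t in 𝓝 0, ‖q t + r t‖ + ‖r t‖ < ρ :=
    ((hq.add hr).norm.add hr.norm).eventually_lt_const hρ'
  have hev2 : ∀ᶠ t in 𝓝 0, ‖B 1 t - B 0 t‖ < ‖B 1 0 - B 0 0‖ + ‖B 2 0 - B 1 0‖ + 1 :=
    ((hcont 1).sub (hcont 0)).norm.eventually_lt_const
      (by have := norm_nonneg (B 2 0 - B 1 0); simp only [Pi.sub_apply]; linarith)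
  have hev3 : ∀ᶠ t in 𝓝 0, ‖B 2 t - B 1 t‖ < ‖B 1 0 - B 0 0‖ + ‖B 2 0 - B 1 0‖ + 1 :=
    ((hcont 2).sub (hcont 1)).norm.eventually_lt_const
      (by have := norm_nonneg (B 1 0 - B 0 0); simp only [Pi.sub_apply]; linarith)
  set M := ‖B 1 0 - B 0 0‖ + ‖B 2 0 - B 1 0‖ + 1
  rw [← tendsto_add_atTop_iff_nat 2]
  have hτ2 : Tendsto (fun n => τ (n + 2)) atTop (𝓝 0) := hτ.comp (tendsto_add_atTop_nat 2)
  have hdiff : Tendsto (fun n => (1 + (q (τ (n + 2)) + r (τ (n + 2))) + r (τ (n + 2))) *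
      B (n + 2) (τ (n + 2)) - (B 2 (τ (n + 2)) + (q (τ (n + 2)) + r (τ (n + 2))) * B 1 (τ (n + 2)) +
        r (τ (n + 2)) * B 0 (τ (n + 2)))) atTop (𝓝 0) := by
    refine squeeze_zero_norm' (a := fun n => 2 * M * ρ ^ (n / 2)) ?_ ?_
    · filter_upwards [hτ2.eventually (hev1.and (hev2.and (hev3.and hB)))]
        with n ⟨e1, e2, e3, e4⟩
      exact norm_mul_sub_le_of_recurrence (B := fun n => B n _) (by ring) hρ1.le e1.le e4 e2.le
        e3.le n
    · rw [← mul_zero (2 * M)]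
      exact ((tendsto_pow_atTop_nhds_zero_of_lt_one hρ0 hρ1).comp
        (Nat.tendsto_div_const_atTop two_ne_zero)).const_mul _
  have hq' := hq.tendsto.comp hτ2
  have hr' := hr.tendsto.comp hτ2
  have hc : ∀ m, Tendsto (fun n => B m (τ (n + 2))) atTop (𝓝 (B m 0)) :=
    fun m => (hcont m).tendsto.comp hτ2
  have hden := ((hq'.add hr').const_add 1).add hr'
  have hnum := ((hc 2).add ((hq'.add hr').mul (hc 1))).add (hr'.mul (hc 0))
  have := (hdiff.add hnum).div hden h1
  rw [zero_add] at this
  refine this.congr' ?_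
  filter_upwards [hden.eventually_ne h1] with n hn
  simp only [Function.comp_apply] at hn ⊢
  rw [Pi.div_apply, sub_add_cancel, mul_div_cancel_left₀ _ hn]

/-! ### The dominant root as a function of `t` -/

theorem exists_tribonacci_root :
    ∃ x : ℝ, 0.5436885 ≤ x ∧ x ≤ 0.5436895 ∧ x + x ^ 2 + x ^ 3 = 1 := by
  have h : ContinuousOn (fun x : ℝ => x + x ^ 2 + x ^ 3) (Set.Icc 0.5436885 0.5436895) := by
    fun_prop
  obtain ⟨x, hx, hx1⟩ := intermediate_value_Icc (by norm_num) h
    (show (1 : ℝ) ∈ Set.Icc _ _ by constructor <;> norm_num)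
  exact ⟨x, hx.1, hx.2, hx1⟩

/-- The solution `x` of `x + x² + x³ = exp (-i t L)` which passes through the positive solution
at `t = 0`. -/
theorem exists_branch {x₀ : ℝ} (hx₀ : 0 < x₀) (h : x₀ + x₀ ^ 2 + x₀ ^ 3 = 1) (L : ℝ) :
    ∃ x : ℝ → ℂ, x 0 = x₀ ∧ ContDiffAt ℝ 1 x 0 ∧
      ∀ᶠ t : ℝ in 𝓝 0, x t + x t ^ 2 + x t ^ 3 = Complex.exp (-(t * Complex.I * L)) := by
  let f : ℂ → ℂ := fun z => z + z ^ 2 + z ^ 3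
  have hf : ContDiffAt ℂ 1 f x₀ := by fun_prop
  have hd : HasDerivAt f ((1 + 2 * x₀ + 3 * x₀ ^ 2 : ℝ) : ℂ) x₀ := by
    have := ((hasDerivAt_id (x₀ : ℂ)).add (hasDerivAt_pow 2 (x₀ : ℂ))).add
      (hasDerivAt_pow 3 (x₀ : ℂ))
    convert! this using 1
    simp
  have hne : ((1 + 2 * x₀ + 3 * x₀ ^ 2 : ℝ) : ℂ) ≠ 0 := by
    rw [Complex.ofReal_ne_zero]
    positivity
  -- Inverse function theorem for `z + z² + z³` at `x₀`.
  have hd' := hd.hasFDerivAt_equiv hne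
  let e := hf.toOpenPartialHomeomorph f hd' one_ne_zero
  have hfx : f x₀ = 1 := by
    simp only [f]
    exact_mod_cast h
  let w : ℝ → ℂ := fun t => Complex.exp (-(t * Complex.I * L))
  have hw : ContDiff ℝ 1 w := by
    have : ContDiff ℝ 1 (fun t : ℝ => (t : ℂ)) := Complex.ofRealCLM.contDiff
    exact (((this.mul contDiff_const).mul contDiff_const).neg).cexp
  have hw0 : w 0 = f x₀ := by simp [w, hfx]
  refine ⟨fun t => hf.localInverse hd' one_ne_zero (w t), ?_, ?_, ?_⟩
  · change hf.localInverse hd' one_ne_zero (w 0) = x₀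
    rw [hw0]
    exact hf.localInverse_apply_image hd' one_ne_zero
  · have h1 := (hf.to_localInverse hd' one_ne_zero).restrict_scalars ℝ
    rw [← hw0] at h1
    exact h1.comp (0 : ℝ) hw.contDiffAt
  · have ht : ∀ᶠ y in 𝓝 (w 0), y ∈ e.target := by
      rw [hw0]
      exact e.open_target.mem_nhds (hf.image_mem_toOpenPartialHomeomorph_target hd' one_ne_zero)
    filter_upwards [hw.continuous.continuousAt.eventually ht] with t ht
    exact e.right_inv ht

/-- Implicit differentiation, with the exponential replaced by `x + x² + x³`. It expresses `x'`
through `x`, so a `C¹` branch is enough for a second derivative. -/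
theorem eventually_hasDerivAt_of_equation {x : ℝ → ℂ} {x₀ L : ℝ} (hx₀ : 0 < x₀) (h0 : x 0 = x₀)
    (hx : ContDiffAt ℝ 1 x 0)
    (heq : ∀ᶠ t : ℝ in 𝓝 0, x t + x t ^ 2 + x t ^ 3 = Complex.exp (-(t * Complex.I * L))) :
    ∀ᶠ t in 𝓝 0, HasDerivAt x
      (-(Complex.I * L) * (x t * ((1 + x t + x t ^ 2) / (1 + 2 * x t + 3 * x t ^ 2)))) t := by
  have hc := hx.continuousAt
  have hne : ∀ᶠ t in 𝓝 0, 1 + 2 * x t + 3 * x t ^ 2 ≠ 0 := by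
    refine ContinuousAt.eventually_ne (by fun_prop) ?_
    rw [h0]
    norm_cast
    positivity
  filter_upwards [heq.eventually_nhds, hne, hx.eventually (by simp)] with t h1 h2 h3
  have hd := (h3.differentiableAt one_ne_zero).hasDerivAt
  have hl := (hd.add (hd.pow 2)).add (hd.pow 3)
  have hr : HasDerivAt (fun t : ℝ => Complex.exp (-(t * Complex.I * L)))
      (Complex.exp (-(t * Complex.I * L)) * -(1 * Complex.I * L)) t :=
    (((Complex.ofRealCLM.hasDerivAt (x := t)).mul_const _).mul_const _).neg.cexp
  have huniq := (hl.congr_of_eventuallyEq (h1.mono fun s hs => hs.symm)).unique hr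
  rw [← h1.self_of_nhds] at huniq
  convert! hd using 1
  rw [mul_div_assoc', mul_div_assoc', div_eq_iff h2]
  simp at huniq
  linear_combination -huniq

/-- The expansion of order two of `x₀ / x t * exp (- i μ t)` at `t = 0`. -/
theorem isLittleO_branch {x : ℝ → ℂ} {x₀ L μ v : ℝ} (hx₀ : 0 < x₀) (h0 : x 0 = x₀)
    (hx : ContDiffAt ℝ 1 x 0)
    (heq : ∀ᶠ t : ℝ in 𝓝 0, x t + x t ^ 2 + x t ^ 3 = Complex.exp (-(t * Complex.I * L)))
    (hμ : μ = L * ((1 + x₀ + x₀ ^ 2) / (1 + 2 * x₀ + 3 * x₀ ^ 2)))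
    (hv : v = L ^ 2 * ((x₀ + x₀ ^ 2 + x₀ ^ 3) * (1 + 4 * x₀ + x₀ ^ 2) /
      (1 + 2 * x₀ + 3 * x₀ ^ 2) ^ 3)) :
    (fun t : ℝ => x₀ / x t * Complex.exp (-(t * Complex.I * μ)) - (1 + -v * (t : ℂ) ^ 2 / 2))
      =o[𝓝 0] fun t : ℝ => t ^ 2 := by
  have hx₀' : (x₀ : ℂ) ≠ 0 := by exact_mod_cast hx₀.ne'
  have hden : (1 + 2 * x₀ + 3 * x₀ ^ 2 : ℂ) ≠ 0 := by
    norm_cast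
    positivity
  have hμ' : (μ : ℂ) = L * ((1 + x₀ + x₀ ^ 2) / (1 + 2 * x₀ + 3 * x₀ ^ 2)) := by
    rw [hμ]
    push_cast
    rfl
  have hd := eventually_hasDerivAt_of_equation hx₀ h0 hx heq
  let h : ℝ → ℂ := fun t => x₀ / x t * Complex.exp (-(t * Complex.I * μ))
  -- `k` is `h'`, computed as `h` times its logarithmic derivative; `μ` is chosen to make it vanish
  -- at 0.
  let k : ℝ → ℂ := fun t => Complex.I *
    (L * ((1 + x t + x t ^ 2) / (1 + 2 * x t + 3 * x t ^ 2)) - μ) * h t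
  have hne : ∀ᶠ t in 𝓝 0, x t ≠ 0 :=
    hx.continuousAt.eventually_ne (by rwa [h0])
  have hh : ∀ᶠ t in 𝓝 0, HasDerivAt h (k t) t := by
    filter_upwards [hd, hne] with t h1 h2
    have hr : HasDerivAt (fun t : ℝ => Complex.exp (-(t * Complex.I * μ)))
        (Complex.exp (-(t * Complex.I * μ)) * -(1 * Complex.I * μ)) t :=
      (((Complex.ofRealCLM.hasDerivAt (x := t)).mul_const _).mul_const _).neg.cexp
    have := ((hasDerivAt_const t (x₀ : ℂ)).div h1 h2).mul hr
    convert! this using 1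
    simp only [k, h, Pi.div_apply]
    field_simp
    ring
  have hk0 : k 0 = 0 := by
    simp only [k, h0]
    rw [← hμ']
    simp
  -- The quotient `(1 + x + x²) / (1 + 2x + 3x²)` has derivative `-(1 + 4x + x²) / (1 + 2x + 3x²)²`;
  -- multiplying by `i L x'(0)` gives `-v`.
  have hk : HasDerivAt k (-v : ℂ) 0 := by
    have hd0 := hd.self_of_nhds
    have hh0 := hh.self_of_nhds
    have hn := (hd0.const_add 1).add (hd0.pow 2)
    have hm := ((hd0.const_mul 2).const_add 1).add ((hd0.pow 2).const_mul 3)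
    have := ((((hn.div hm (by simpa [h0] using hden)).const_mul (L : ℂ)).sub_const
      (μ : ℂ)).const_mul Complex.I).mul hh0
    convert! this using 1
    rw [hk0, mul_zero, add_zero]
    have hh0' : h 0 = 1 := by simp [h, h0, hx₀']
    simp only [hh0', h0, Pi.add_apply, Pi.pow_apply, hv]
    push_cast
    field_simp
    ring_nf
    simp [Complex.I_sq]
    ring
  have := isLittleO_sub_sub_of_hasDerivAt hh hk0 hk
  have hh0' : h 0 = 1 := by simp [h, h0, hx₀']
  rw [hh0'] at this
  exact this

/-! ### Convergence of characteristic functions -/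

/-- At `t = s / (σ√n)` one has `σ² t² = s² / n`, so the base is `1 - s² / (2n) + o(1/n)`. -/
theorem tendsto_branch_pow {g : ℝ → ℂ} {σ : ℝ} (hσ : 0 < σ)
    (hg : (fun t : ℝ => g t - (1 + -(σ ^ 2 : ℝ) * (t : ℂ) ^ 2 / 2)) =o[𝓝 0] fun t : ℝ => t ^ 2)
    (s : ℝ) :
    Tendsto (fun n : ℕ => g (s / (σ * √n)) ^ n) atTop (𝓝 (Complex.exp (-s ^ 2 / 2))) := by
  have hσ' : (σ : ℂ) ≠ 0 := by exact_mod_cast hσ.ne'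
  apply Complex.tendsto_pow_exp_of_isLittleO_sub_add_div
  have hτ : Tendsto (fun n : ℕ => s / (σ * √n)) atTop (𝓝 0) :=
    ((Real.tendsto_sqrt_atTop.comp tendsto_natCast_atTop_atTop).const_mul_atTop hσ).const_div_atTop s
  have h1 := hg.comp_tendsto hτ
  have h2 : ∀ n : ℕ, (s / (σ * √n)) ^ 2 = s ^ 2 / σ ^ 2 * (1 / n) := by
    intro n
    rw [div_pow, mul_pow, Real.sq_sqrt n.cast_nonneg, div_mul_div_comm, mul_one]
  have h3 : (fun n : ℕ => (s / (σ * √n)) ^ 2) =O[atTop] fun n : ℕ => 1 / (n : ℂ) := by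
    simp_rw [h2]
    refine IsBigO.const_mul_left ?_ _
    refine IsBigO.of_norm_norm (isBigO_of_le _ fun n => ?_)
    simp
  refine (h1.trans_isBigO h3).congr_left fun n => ?_
  have h4 : ((s / (σ * √n) : ℝ) : ℂ) ^ 2 = s ^ 2 / σ ^ 2 * (1 / n) := by
    rw [← Complex.ofReal_pow, h2 n]
    push_cast
    rfl
  simp only [Function.comp_apply, h4]
  congr 2
  push_cast
  field_simp

/-- The hypothesis `hx₁` is the contraction condition `‖q + r‖ + ‖r‖ < 1` at `t = 0`. -/
theorem tendsto_charFun_log_invProb {x₀ μ σ : ℝ} (hx₀ : 0 < x₀) (hx₁ : x₀ ^ 2 + 2 * x₀ ^ 3 < 1)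
    (h : x₀ + x₀ ^ 2 + x₀ ^ 3 = 1) (hσ : 0 < σ)
    (hμ : μ = Real.log 3 * ((1 + x₀ + x₀ ^ 2) / (1 + 2 * x₀ + 3 * x₀ ^ 2)))
    (hv : σ ^ 2 = Real.log 3 ^ 2 * ((x₀ + x₀ ^ 2 + x₀ ^ 3) * (1 + 4 * x₀ + x₀ ^ 2) /
      (1 + 2 * x₀ + 3 * x₀ ^ 2) ^ 3)) (s : ℝ) :
    Tendsto (fun n : ℕ => charFun ((uniform n).map fun π =>
      (Real.log (invProb π.1) - μ * n) / (σ * √n)) s) atTop (𝓝 (Complex.exp (-s ^ 2 / 2))) := by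
  obtain ⟨x, h0, hx, heq⟩ := exists_branch hx₀ h (Real.log 3)
  have hx₀' : (x₀ : ℂ) ≠ 0 := by exact_mod_cast hx₀.ne'
  have hpow := tendsto_branch_pow hσ (isLittleO_branch hx₀ h0 hx heq hμ hv) s
  have hτ : Tendsto (fun n : ℕ => s / (σ * √n)) atTop (𝓝 0) :=
    ((Real.tendsto_sqrt_atTop.comp tendsto_natCast_atTop_atTop).const_mul_atTop hσ).const_div_atTop s
  let e : ℝ → ℂ := fun t => Complex.exp (t * Complex.I * Real.log 3)
  have he : Continuous e := by fun_prop
  have he0 : e 0 = 1 := by simp [e]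
  have hxc := hx.continuousAt
  let q : ℝ → ℂ := fun t => e t * x t ^ 2
  let r : ℝ → ℂ := fun t => e t * x t ^ 3
  let B : ℕ → ℝ → ℂ := fun n t => expSum n t * x t ^ n
  have hq0 : q 0 = (x₀ ^ 2 : ℝ) := by simp [q, he0, h0]
  have hr0 : r 0 = (x₀ ^ 3 : ℝ) := by simp [r, he0, h0]
  have hB0 : ∀ n, B n 0 = ((twoFib n).card * x₀ ^ n : ℝ) := by
    intro n
    simp [B, expSum_zero, h0]
  have hcard : ∀ n, 0 < ((twoFib n).card : ℝ) := fun n =>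
    Nat.cast_pos.2 (Finset.card_pos.2 ⟨1, one_mem_twoFib n⟩)
  have hB : ∀ᶠ t in 𝓝 0, ∀ n,
      B (n + 3) t = (1 - q t - r t) * B (n + 2) t + q t * B (n + 1) t + r t * B n t := by
    filter_upwards [heq] with t ht n
    have h1 : 1 - q t - r t = e t * x t := by
      have : e t * (x t + x t ^ 2 + x t ^ 3) = 1 := by
        rw [ht, ← Complex.exp_add, add_neg_cancel, Complex.exp_zero]
      simp only [q, r]
      linear_combination -this
    simp only [h1, B, expSum_add_three, q, r, e]
    ring
  have hlim : ∀ τ : ℕ → ℝ, Tendsto τ atTop (𝓝 0) → Tendsto (fun n => B n (τ n)) atTop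
      (𝓝 ((B 2 0 + (q 0 + r 0) * B 1 0 + r 0 * B 0 0) / (1 + (q 0 + r 0) + r 0))) := by
    intro τ hτ
    refine tendsto_of_recurrence (q := q) (r := r) (he.continuousAt.mul (hxc.pow 2))
      (he.continuousAt.mul (hxc.pow 3)) ?_ ?_ (fun n =>
        (continuous_expSum n).continuousAt.mul (hxc.pow n)) hB hτ
    · rw [hq0, hr0, ← Complex.ofReal_add, Complex.norm_of_nonneg (by positivity),
        Complex.norm_of_nonneg (by positivity)]
      linarith
    · rw [hq0, hr0]
      norm_cast
      positivity
  have hlim0 : (B 2 0 + (q 0 + r 0) * B 1 0 + r 0 * B 0 0) / (1 + (q 0 + r 0) + r 0) ≠ 0 := by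
    have h2 := hcard 2
    have h1 := hcard 1
    have h0 := hcard 0
    simp only [hq0, hr0, hB0]
    rw [← Complex.ofReal_add, ← Complex.ofReal_mul, ← Complex.ofReal_mul, ← Complex.ofReal_add,
      ← Complex.ofReal_add, ← Complex.ofReal_one, ← Complex.ofReal_add, ← Complex.ofReal_add,
      ← Complex.ofReal_div, Complex.ofReal_ne_zero]
    positivity
  -- The limit does not depend on the parameter sequence, so comparing `τ` with the constant 0 gives
  -- ratio 1.
  have hratio := (hlim _ hτ).div (hlim _ tendsto_const_nhds) hlim0
  rw [div_self hlim0] at hratio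
  have := hpow.mul hratio
  rw [mul_one] at this
  refine this.congr' ?_
  filter_upwards [hτ.eventually (hxc.eventually_ne (by rwa [h0] : x 0 ≠ 0))] with n hn
  rw [charFun_uniform_map]
  simp only [Pi.div_apply, B, h0]
  generalize s / (σ * √n) = t at hn ⊢
  have hexp : Complex.exp (-(t : ℝ) * Complex.I * (μ * n : ℝ)) =
      Complex.exp (-(t * Complex.I * μ)) ^ n := by
    rw [← Complex.exp_nat_mul]
    congr 1
    push_cast
    ring
  have hne : expSum n 0 ≠ 0 := by
    rw [expSum_zero]
    exact_mod_cast (hcard n).ne'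
  rw [hexp, mul_pow, div_pow]
  field_simp

/-! ### Numerical values of the constants -/

theorem mean_bounds {x : ℝ} (h1 : 0.5436885 ≤ x) (h2 : x ≤ 0.5436895) :
    |Real.log 3 * ((1 + x + x ^ 2) / (1 + 2 * x + 3 * x ^ 2)) - 0.6794| ≤ 0.00005 := by
  have l1 := Real.log_three_gt_d9
  have l2 := Real.log_three_lt_d9
  have hx : (0.5436885 : ℝ) ^ 2 ≤ x ^ 2 := by gcongr
  have hx' : x ^ 2 ≤ (0.5436895 : ℝ) ^ 2 := by gcongr
  have r1 : 0.61841 ≤ (1 + x + x ^ 2) / (1 + 2 * x + 3 * x ^ 2) := by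
    rw [le_div_iff₀ (by positivity)]
    linarith
  have r2 : (1 + x + x ^ 2) / (1 + 2 * x + 3 * x ^ 2) ≤ 0.61843 := by
    rw [div_le_iff₀ (by positivity)]
    linarith
  generalize (1 + x + x ^ 2) / (1 + 2 * x + 3 * x ^ 2) = y at *
  rw [abs_le]
  constructor <;> nlinarith

theorem variance_bounds {x : ℝ} (h1 : 0.5436885 ≤ x) (h2 : x ≤ 0.5436895)
    (h : x + x ^ 2 + x ^ 3 = 1) :
    |Real.log 3 ^ 2 * ((x + x ^ 2 + x ^ 3) * (1 + 4 * x + x ^ 2) / (1 + 2 * x + 3 * x ^ 2) ^ 3)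
      - 0.1592| ≤ 0.00005 := by
  have l1 : (1.0986122 : ℝ) ^ 2 ≤ Real.log 3 ^ 2 := by
    gcongr
    linarith [Real.log_three_gt_d9]
  have l2 : Real.log 3 ^ 2 ≤ (1.0986123 : ℝ) ^ 2 := by
    have := Real.log_three_gt_d9
    gcongr
    linarith [Real.log_three_lt_d9]
  have hx : (0.5436885 : ℝ) ^ 2 ≤ x ^ 2 := by gcongr
  have hx' : x ^ 2 ≤ (0.5436895 : ℝ) ^ 2 := by gcongr
  -- Bounding the cubed denominator by constants leaves inequalities linear in `x` and `x ^ 2`.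
  have d1 : (2.974165 : ℝ) ^ 3 ≤ (1 + 2 * x + 3 * x ^ 2) ^ 3 := by
    gcongr
    linarith
  have d2 : (1 + 2 * x + 3 * x ^ 2) ^ 3 ≤ (2.974175 : ℝ) ^ 3 := by
    gcongr
    linarith
  have r1 : 0.13189 ≤ (1 + 4 * x + x ^ 2) / (1 + 2 * x + 3 * x ^ 2) ^ 3 := by
    rw [le_div_iff₀ (by positivity)]
    linarith
  have r2 : (1 + 4 * x + x ^ 2) / (1 + 2 * x + 3 * x ^ 2) ^ 3 ≤ 0.13192 := by
    rw [div_le_iff₀ (by positivity)]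
    linarith
  rw [h, one_mul]
  generalize (1 + 4 * x + x ^ 2) / (1 + 2 * x + 3 * x ^ 2) ^ 3 = y at *
  rw [abs_le]
  constructor <;> nlinarith

end FibMatching

end

/-- Central limit theorem for `log T(π)` under the uniform measure on 2-Fibonacci permutations,
where `T(π)⁻¹` is the probability of `π` under the fixed order algorithm. -/
theorem mainTheorem6 :
    ∃ μ σ : ℝ,
      |μ - 0.6794| ≤ 0.00005 ∧ 0 < σ ∧ |σ ^ 2 - 0.1592| ≤ 0.00005 ∧
      TendstoInDistribution
        (fun (n : ℕ) (π : FibMatching.twoFib n) =>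
          (Real.log (FibMatching.invProb π.1) - μ * (n : ℝ)) / (σ * √(n : ℝ)))
        atTop (fun x : ℝ => x) FibMatching.uniform (gaussianReal 0 1) := by
  obtain ⟨x, hx1, hx2, hx⟩ := FibMatching.exists_tribonacci_root
  have hx0 : 0 < x := by linarith
  have hlog : 0 < Real.log 3 := Real.log_pos (by norm_num)
  have hv : 0 < Real.log 3 ^ 2 * ((x + x ^ 2 + x ^ 3) * (1 + 4 * x + x ^ 2) /
      (1 + 2 * x + 3 * x ^ 2) ^ 3) := by positivity
  refine ⟨_, √_, FibMatching.mean_bounds hx1 hx2, Real.sqrt_pos.2 hv, ?_, ?_⟩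
  · rw [Real.sq_sqrt hv.le]
    exact FibMatching.variance_bounds hx1 hx2 hx
  · refine ⟨fun n => (measurable_of_finite _).aemeasurable, by fun_prop, ?_⟩
    refine ProbabilityMeasure.tendsto_iff_tendsto_charFun.2 fun s => ?_
    have hx3 : x ^ 2 + 2 * x ^ 3 < 1 := by
      have : (0.5436885 : ℝ) ^ 2 ≤ x ^ 2 := by gcongr
      linarith
    have := FibMatching.tendsto_charFun_log_invProb hx0 hx3 hx (Real.sqrt_pos.2 hv) rfl
      (Real.sq_sqrt hv.le) s
    simpa [charFun_gaussianReal, neg_div] using this
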